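/- A graph here is a finite undirected multigraph (parallel edges allowed). A local antimagic labeling of a connected graph $G$ with edge set $E$ is a bijection $f:E\to\{1,\dots,|E|\}$ such that $f^+(x)\ne f^+(y)$ for all adjacent vertices $x,y$, where $f^+(x)$ is the sum of $f(e)$ over all edges $e$ incident to $x$; $\chi_{la}(G)$ is the minimum, over all local antimagic labelings $f$ of $G$, of the number of distinct values of $f^+$ on the vertices. Let $C_n=v_0v_1\cdots v_{n-1}v_0$ be the $n$-cycle with its edges labeled by $f(v_jv_{j+1})=(j+2)/2$ for even $j$ and $f(v_jv_{j+1})=n-(j-1)/2$ for odd $j$ ($0\le j\le n-1$, $v_n=v_0$). Given a family of disjoint blocks of vertices of $C_n$, merge the vertices of each block into one vertex, keeping all $n$ edges and their labels. For $k\ge 2$ define in this way the following graphs; a pair or triple of integers is the block of the vertices with these subscripts, and the blocks are the members of $\mathscr A\cup\mathscr B\cup\mathscr C$. - $G_{4k+2}$: $n=8k+4$; $\mathscr A=\{(2i,4k+2i+2): 0\le i\le 2k\}$; $\mathscr B=\{(2j+1,2k+2j+3): 0\le j\le k\}\cup\{(4k+2j+5,6k+2j+5): 0\le j\le k-1\}$;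 $\mathscr C=\emptyset$. - $G^1_{4k+1}$: $n=8k+2$; $\mathscr A=\{(2i,4k+2i): 1\le i\le 2k\}$; $\mathscr B=\{(2j+1,4k+2j+3): 0\le j\le 2k-1\}$; $\mathscr C=\{(0,4k+1)\}$. - $G^1_{4k+3}$: $n=8k+6$; $\mathscr A=\{(2i,4k+2+2i): 1\le i\le 2k+1\}$; $\mathscr B=\{(2j+1,6k+5+2j): 0\le j\le k\}\cup\{(2k+3+2j,4k+5+2j): 0\le j\le k-1\}$; $\mathscr C=\{(0,4k+3)\}$. - $G^2_{4k+1}$: $n=8k+1$; $\mathscr A=\{(2i,4k+2i): 1\le i\le 2k\}$; $\mathscr B=\{(2j+1,2k+2j+1): 0\le j\le k-1\}\cup\{(4k+2j+1,6k+2j+1): 0\le j\le k-1\}$; $\mathscr C=\{(0)\}$ ($v_0$ is not merged). - $G^2_{4k+3}$: $n=8k+5$; $\mathscr A=\{(2i,4k+2+2i): 1\le i\le 2k+1\}$; $\mathscr B=\{(2j+1,6k+3+2j): 0\le j\le k\}\cup\{(2k+3+2j,4k+3+2j): 0\le j\le k-1\}$; $\mathscr C=\{(0)\}$. - $G^3_{4k+1}$: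 $n=8k+3$; $\mathscr A=\{(2i,4k+2i): 1\le i\le k\}\cup\{(2k+2i,6k+2+2i): 1\le i\le k\}$; $\mathscr B=\{(2j+1,8k+1-2j): 0\le j\le k-1\}\cup\{(2k+3+2j,4k+3+2j): 0\le j\le k-1\}$; $\mathscr C=\{(0,2k+1,6k+2)\}$. - $G^3_{4k+3}$: $n=8k+7$; $\mathscr A=\{(2i,4k+4+2i): 1\le i\le k\}\cup\{(2k+2+2i,6k+4+2i): 1\le i\le k+1\}$; $\mathscr B=\{(4j+1,4k+3+2j): 0\le j\le k\}\cup\{(4j+3,6k+7+2j): 0\le j\le k-1\}$; $\mathscr C=\{(0,2k+2,6k+5)\}$. **Theorem.** Let $k\ge 2$ and let $G$ be any of these seven graphs. Then $\chi_{la}(G)=3$, and $\chi_{la}(G-e)=3$ whenever $e$ is the edge of $G$ that receives the label $1$ or the label $n$. -/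

import Mathlib

/-! ### Local antimagic labelings of finite multigraphs

Graphs are Mathlib's multigraphs `Graph α β`: parallel edges are allowed. -/

namespace LocalAntimagic

/-- The multigraph `G` is connected: it has a vertex, and any two vertices are joined by a walk. -/
def IsConnected {α β : Type*} (G : Graph α β) : Prop :=
  G.vertexSet.Nonempty ∧
    ∀ x ∈ G.vertexSet, ∀ y ∈ G.vertexSet, Relation.ReflTransGen G.Adj x y

/-- The induced vertex label `f⁺(x)`: the sum of `f e` over all edges `e` incident to `x`. -/
noncomputable def vertexLabel {α β : Type*} (G : Graph α β) (f : β → ℕ) (x : α) : ℕ :=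
  ∑ᶠ e ∈ G.incidenceSet x, f e

/-- `f` is a local antimagic labeling of the connected multigraph `G`: it restricts to a bijection
from the edge set onto `{1, …, |E|}`, and adjacent vertices have distinct induced labels. -/
structure IsLocalAntimagic {α β : Type*} (G : Graph α β) (f : β → ℕ) : Prop where
  connected : IsConnected G
  bijOn : Set.BijOn f G.edgeSet (Set.Icc 1 G.edgeSet.ncard)
  ne_of_adj : ∀ x y, G.Adj x y → vertexLabel G f x ≠ vertexLabel G f y

/-- The color number `c(f)`: the number of distinct induced vertex labels. -/
noncomputable def colorNumber {α β : Type*} (G : Graph α β) (f : β → ℕ) : ℕ∞ :=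
  (vertexLabel G f '' G.vertexSet).encard

/-- The local antimagic chromatic number: the minimum of `c(f)` over all local antimagic
labelings `f` of `G` (and `⊤` if there is none). -/
noncomputable def chiLa {α β : Type*} (G : Graph α β) : ℕ∞ :=
  ⨅ (f : β → ℕ) (_ : IsLocalAntimagic G f), colorNumber G f

/-! ### Merging vertices of a labeled cycle -/

/-- The cycle `v₀ v₁ ⋯ v_{n-1} v₀`. The number `j < n` stands for the vertex `v_j`, and also for
the edge `v_j v_{j+1}` (subscripts modulo `n`). -/
def cycle (n : ℕ) : Graph ℕ ℕ where
  vertexSet := Set.Iio n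
  edgeSet := Set.Iio n
  IsLink e x y := e < n ∧ ((x = e ∧ y = (e + 1) % n) ∨ (x = (e + 1) % n ∧ y = e))
  isLink_symm := by
    intro e _
    constructor
    rintro x y ⟨he, h | h⟩
    · exact ⟨he, Or.inr ⟨h.2, h.1⟩⟩
    · exact ⟨he, Or.inl ⟨h.2, h.1⟩⟩
  eq_or_eq_of_isLink_of_isLink := by
    rintro e x y v w ⟨_, ⟨rfl, rfl⟩ | ⟨rfl, rfl⟩⟩ ⟨_, ⟨rfl, rfl⟩ | ⟨rfl, rfl⟩⟩ <;> simp
  edge_mem_iff_exists_isLink := by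
    intro e
    constructor
    · intro he
      exact ⟨e, (e + 1) % n, he, Or.inl ⟨rfl, rfl⟩⟩
    · rintro ⟨x, y, he, _⟩
      exact he
  left_mem_of_isLink := by
    rintro e x y ⟨he, ⟨rfl, _⟩ | ⟨rfl, _⟩⟩
    · exact he
    · exact Nat.mod_lt _ (by omega)

/-- The `C`-labeling of the `n`-cycle: the label of the edge `v_j v_{j+1}`. -/
def cLabel (n j : ℕ) : ℕ := if Even j then (j + 2) / 2 else n - (j - 1) / 2

/-- A merging of vertices of the `n`-cycle: all vertices whose subscripts lie in a common block
are to be merged into one vertex. -/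
structure CycleMerging where
  n : ℕ
  blocks : Set (Set ℕ)

/-- The vertices after merging. -/
def CycleMerging.Vertex (S : CycleMerging) : Type :=
  Quot fun x y : ℕ => ∃ b ∈ S.blocks, x ∈ b ∧ y ∈ b

/-- The multigraph obtained from the `n`-cycle by merging. Its edges are those of the cycle, so
that the `C`-labeling `cLabel S.n` is also a labeling of it. -/
def CycleMerging.graph (S : CycleMerging) : Graph S.Vertex ℕ :=
  (cycle S.n).map (Quot.mk _)

/-! ### The seven constructions

In each of them the three (or two) parts of the union are the families `𝒜`, `ℬ` (and `𝒞`). -/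

/-- `G_{4k+2}(𝒜, ℬ)`, from the cycle of length `8k + 4`. -/
def G0Two (k : ℕ) : CycleMerging where
  n := 8 * k + 4
  blocks :=
    {b | ∃ i, i ≤ 2 * k ∧ b = {2 * i, 4 * k + 2 * i + 2}} ∪
    ({b | ∃ j, j ≤ k ∧ b = {2 * j + 1, 2 * k + 2 * j + 3}} ∪
      {b | ∃ j, j < k ∧ b = {4 * k + 2 * j + 5, 6 * k + 2 * j + 5}})

/-- `G¹_{4k+1}(𝒜, ℬ, 𝒞)`, from the cycle of length `8k + 2`. -/
def G1One (k : ℕ) : CycleMerging where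
  n := 8 * k + 2
  blocks :=
    {b | ∃ i, 1 ≤ i ∧ i ≤ 2 * k ∧ b = {2 * i, 4 * k + 2 * i}} ∪
    {b | ∃ j, j < 2 * k ∧ b = {2 * j + 1, 4 * k + 2 * j + 3}} ∪
    {{0, 4 * k + 1}}

/-- `G¹_{4k+3}(𝒜, ℬ, 𝒞)`, from the cycle of length `8k + 6`. -/
def G1Three (k : ℕ) : CycleMerging where
  n := 8 * k + 6
  blocks :=
    {b | ∃ i, 1 ≤ i ∧ i ≤ 2 * k + 1 ∧ b = {2 * i, 4 * k + 2 + 2 * i}} ∪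
    ({b | ∃ j, j ≤ k ∧ b = {2 * j + 1, 6 * k + 5 + 2 * j}} ∪
      {b | ∃ j, j < k ∧ b = {2 * k + 3 + 2 * j, 4 * k + 5 + 2 * j}}) ∪
    {{0, 4 * k + 3}}

/-- `G²_{4k+1}(𝒜, ℬ, 𝒞)`, from the cycle of length `8k + 1`. -/
def G2One (k : ℕ) : CycleMerging where
  n := 8 * k + 1
  blocks :=
    {b | ∃ i, 1 ≤ i ∧ i ≤ 2 * k ∧ b = {2 * i, 4 * k + 2 * i}} ∪
    ({b | ∃ j, j < k ∧ b = {2 * j + 1, 2 * k + 2 * j + 1}} ∪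
      {b | ∃ j, j < k ∧ b = {4 * k + 2 * j + 1, 6 * k + 2 * j + 1}}) ∪
    {{0}}

/-- `G²_{4k+3}(𝒜, ℬ, 𝒞)`, from the cycle of length `8k + 5`. -/
def G2Three (k : ℕ) : CycleMerging where
  n := 8 * k + 5
  blocks :=
    {b | ∃ i, 1 ≤ i ∧ i ≤ 2 * k + 1 ∧ b = {2 * i, 4 * k + 2 + 2 * i}} ∪
    ({b | ∃ j, j ≤ k ∧ b = {2 * j + 1, 6 * k + 3 + 2 * j}} ∪
      {b | ∃ j, j < k ∧ b = {2 * k + 3 + 2 * j, 4 * k + 3 + 2 * j}}) ∪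
    {{0}}

/-- `G³_{4k+1}(𝒜, ℬ, 𝒞)`, from the cycle of length `8k + 3`. -/
def G3One (k : ℕ) : CycleMerging where
  n := 8 * k + 3
  blocks :=
    ({b | ∃ i, 1 ≤ i ∧ i ≤ k ∧ b = {2 * i, 4 * k + 2 * i}} ∪
      {b | ∃ i, 1 ≤ i ∧ i ≤ k ∧ b = {2 * k + 2 * i, 6 * k + 2 + 2 * i}}) ∪
    ({b | ∃ j, j < k ∧ b = {2 * j + 1, 8 * k + 1 - 2 * j}} ∪
      {b | ∃ j, j < k ∧ b = {2 * k + 3 + 2 * j, 4 * k + 3 + 2 * j}}) ∪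
    {{0, 2 * k + 1, 6 * k + 2}}

/-- `G³_{4k+3}(𝒜, ℬ, 𝒞)`, from the cycle of length `8k + 7`. -/
def G3Three (k : ℕ) : CycleMerging where
  n := 8 * k + 7
  blocks :=
    ({b | ∃ i, 1 ≤ i ∧ i ≤ k ∧ b = {2 * i, 4 * k + 4 + 2 * i}} ∪
      {b | ∃ i, 1 ≤ i ∧ i ≤ k + 1 ∧ b = {2 * k + 2 + 2 * i, 6 * k + 4 + 2 * i}}) ∪
    ({b | ∃ j, j ≤ k ∧ b = {4 * j + 1, 4 * k + 3 + 2 * j}} ∪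
      {b | ∃ j, j < k ∧ b = {4 * j + 3, 6 * k + 7 + 2 * j}}) ∪
    {{0, 2 * k + 2, 6 * k + 5}}

end LocalAntimagic

namespace LocalAntimagic

/-! ### Blocks of the seven constructions -/

/-- `S` merges the vertices of `C ∋ v₀` into one vertex, no two of them consecutive on the cycle,
and merges all other vertices in pairs of equal parity. -/
structure CycleMerging.IsPairing (S : CycleMerging) (C : Finset ℕ) : Prop where
  n_large : 17 ≤ S.n
  zero_mem : 0 ∈ C
  coe_mem_blocks : (C : Set ℕ) ∈ S.blocks
  lt_of_mem : ∀ x ∈ C, x < S.n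
  succ_notMem : ∀ x ∈ C, (x + 1) % S.n ∉ C
  disjoint : ∀ b ∈ S.blocks, ∀ b' ∈ S.blocks, ∀ x ∈ b, x ∈ b' → ∀ y ∈ b, y ∈ b'
  exists_pair : ∀ x < S.n, x ∉ C → ∃ a b, ({a, b} : Set ℕ) ∈ S.blocks ∧ a < S.n ∧ b < S.n ∧
    a ≠ b ∧ a % 2 = b % 2 ∧ (x = a ∨ x = b)

lemma succ_mod_notMem_of_forall {n : ℕ} {C : Finset ℕ} (hn : 1 < n)
    (h1 : 1 ∉ C) (hlast : n - 1 ∉ C) (hlt : ∀ x ∈ C, x < n)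
    (h : ∀ x ∈ C, x ≠ 0 → x + 1 ∉ C) : ∀ x ∈ C, (x + 1) % n ∉ C := by
  intro x hx
  rcases Nat.lt_or_ge (x + 1) n with hxn | hxn
  · rw [Nat.mod_eq_of_lt hxn]
    rcases eq_or_ne x 0 with rfl | hx0
    · exact h1
    · exact h x hx hx0
  · have := hlt x hx
    exact absurd ((by omega : x = n - 1) ▸ hx) hlast

lemma G0Two_isPairing {k : ℕ} (hk : 2 ≤ k) : (G0Two k).IsPairing {0, 4 * k + 2} where
  n_large := by simp only [G0Two]; omega
  zero_mem := by simp
  coe_mem_blocks := Or.inl ⟨0, by omega, by simp⟩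
  lt_of_mem := by simp [G0Two]; omega
  succ_notMem := by
    apply succ_mod_notMem_of_forall <;> simp [G0Two] <;> omega
  disjoint := by
    rintro b ((⟨i, hi, rfl⟩) | (⟨i, hi, rfl⟩ | ⟨i, hi, rfl⟩))
      b' ((⟨j, hj, rfl⟩) | (⟨j, hj, rfl⟩ | ⟨j, hj, rfl⟩)) x hx hx' y hy <;>
    simp only [Set.mem_insert_iff, Set.mem_singleton_iff] at hx hx' hy ⊢ <;> omega
  exists_pair := by
    intro x hx hxC
    simp only [G0Two, Finset.mem_insert, Finset.mem_singleton] at hx hxC ⊢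
    by_cases h2 : x % 2 = 0
    · by_cases h : x < 4 * k + 2
      · exact ⟨_, _, Or.inl ⟨x / 2, by omega, rfl⟩, by omega⟩
      · exact ⟨_, _, Or.inl ⟨(x - (4 * k + 2)) / 2, by omega, rfl⟩, by omega⟩
    · by_cases h : x < 2 * k + 3
      · exact ⟨_, _, Or.inr (Or.inl ⟨x / 2, by omega, rfl⟩), by omega⟩
      by_cases h : x < 4 * k + 5
      · exact ⟨_, _, Or.inr (Or.inl ⟨(x - (2 * k + 3)) / 2, by omega, rfl⟩), by omega⟩
      by_cases h : x < 6 * k + 5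
      · exact ⟨_, _, Or.inr (Or.inr ⟨(x - (4 * k + 5)) / 2, by omega, rfl⟩), by omega⟩
      · exact ⟨_, _, Or.inr (Or.inr ⟨(x - (6 * k + 5)) / 2, by omega, rfl⟩), by omega⟩

lemma G1One_isPairing {k : ℕ} (hk : 2 ≤ k) : (G1One k).IsPairing {0, 4 * k + 1} where
  n_large := by simp only [G1One]; omega
  zero_mem := by simp
  coe_mem_blocks := Or.inr (by simp)
  lt_of_mem := by simp [G1One]; omega
  succ_notMem := by
    apply succ_mod_notMem_of_forall <;> simp [G1One] <;> omega
  disjoint := by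
    rintro b ((⟨i, hi, hi', rfl⟩ | ⟨i, hi, rfl⟩) | rfl)
      b' ((⟨j, hj, hj', rfl⟩ | ⟨j, hj, rfl⟩) | rfl) x hx hx' y hy <;>
    simp only [Set.mem_insert_iff, Set.mem_singleton_iff] at hx hx' hy ⊢ <;> omega
  exists_pair := by
    intro x hx hxC
    simp only [G1One, Finset.mem_insert, Finset.mem_singleton] at hx hxC ⊢
    by_cases h2 : x % 2 = 0
    · by_cases h : x ≤ 4 * k
      · exact ⟨_, _, Or.inl (Or.inl ⟨x / 2, by omega, by omega, rfl⟩), by omega⟩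
      · exact ⟨_, _, Or.inl (Or.inl ⟨(x - 4 * k) / 2, by omega, by omega, rfl⟩), by omega⟩
    · by_cases h : x < 4 * k
      · exact ⟨_, _, Or.inl (Or.inr ⟨x / 2, by omega, rfl⟩), by omega⟩
      · exact ⟨_, _, Or.inl (Or.inr ⟨(x - (4 * k + 3)) / 2, by omega, rfl⟩), by omega⟩

lemma G1Three_isPairing {k : ℕ} (hk : 2 ≤ k) : (G1Three k).IsPairing {0, 4 * k + 3} where
  n_large := by simp only [G1Three]; omega
  zero_mem := by simp
  coe_mem_blocks := Or.inr (by simp)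
  lt_of_mem := by simp [G1Three]; omega
  succ_notMem := by
    apply succ_mod_notMem_of_forall <;> simp [G1Three] <;> omega
  disjoint := by
    rintro b ((⟨i, hi, hi', rfl⟩ | (⟨i, hi, rfl⟩ | ⟨i, hi, rfl⟩)) | rfl)
      b' ((⟨j, hj, hj', rfl⟩ | (⟨j, hj, rfl⟩ | ⟨j, hj, rfl⟩)) | rfl) x hx hx' y hy <;>
    simp only [Set.mem_insert_iff, Set.mem_singleton_iff] at hx hx' hy ⊢ <;> omega
  exists_pair := by
    intro x hx hxC
    simp only [G1Three, Finset.mem_insert, Finset.mem_singleton] at hx hxC ⊢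
    by_cases h2 : x % 2 = 0
    · by_cases h : x ≤ 4 * k + 2
      · exact ⟨_, _, Or.inl (Or.inl ⟨x / 2, by omega, by omega, rfl⟩), by omega⟩
      · exact ⟨_, _, Or.inl (Or.inl ⟨(x - (4 * k + 2)) / 2, by omega, by omega, rfl⟩), by omega⟩
    · by_cases h : x < 2 * k + 3
      · exact ⟨_, _, Or.inl (Or.inr (Or.inl ⟨x / 2, by omega, rfl⟩)), by omega⟩
      by_cases h : x < 4 * k + 3
      · exact ⟨_, _, Or.inl (Or.inr (Or.inr ⟨(x - (2 * k + 3)) / 2, by omega, rfl⟩)), by omega⟩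
      by_cases h : x < 6 * k + 5
      · exact ⟨_, _, Or.inl (Or.inr (Or.inr ⟨(x - (4 * k + 5)) / 2, by omega, rfl⟩)), by omega⟩
      · exact ⟨_, _, Or.inl (Or.inr (Or.inl ⟨(x - (6 * k + 5)) / 2, by omega, rfl⟩)), by omega⟩

lemma G2One_isPairing {k : ℕ} (hk : 2 ≤ k) : (G2One k).IsPairing {0} where
  n_large := by simp only [G2One]; omega
  zero_mem := by simp
  coe_mem_blocks := Or.inr (by simp)
  lt_of_mem := by simp [G2One]
  succ_notMem := by
    apply succ_mod_notMem_of_forall <;> simp [G2One] <;> omega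
  disjoint := by
    rintro b ((⟨i, hi, hi', rfl⟩ | (⟨i, hi, rfl⟩ | ⟨i, hi, rfl⟩)) | rfl)
      b' ((⟨j, hj, hj', rfl⟩ | (⟨j, hj, rfl⟩ | ⟨j, hj, rfl⟩)) | rfl) x hx hx' y hy <;>
    simp only [Set.mem_insert_iff, Set.mem_singleton_iff] at hx hx' hy ⊢ <;> omega
  exists_pair := by
    intro x hx hxC
    simp only [G2One, Finset.mem_singleton] at hx hxC ⊢
    by_cases h2 : x % 2 = 0
    · by_cases h : x ≤ 4 * k
      · exact ⟨_, _, Or.inl (Or.inl ⟨x / 2, by omega, by omega, rfl⟩), by omega⟩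
      · exact ⟨_, _, Or.inl (Or.inl ⟨(x - 4 * k) / 2, by omega, by omega, rfl⟩), by omega⟩
    · by_cases h : x < 2 * k + 1
      · exact ⟨_, _, Or.inl (Or.inr (Or.inl ⟨x / 2, by omega, rfl⟩)), by omega⟩
      by_cases h : x < 4 * k + 1
      · exact ⟨_, _, Or.inl (Or.inr (Or.inl ⟨(x - (2 * k + 1)) / 2, by omega, rfl⟩)), by omega⟩
      by_cases h : x < 6 * k + 1
      · exact ⟨_, _, Or.inl (Or.inr (Or.inr ⟨(x - (4 * k + 1)) / 2, by omega, rfl⟩)), by omega⟩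
      · exact ⟨_, _, Or.inl (Or.inr (Or.inr ⟨(x - (6 * k + 1)) / 2, by omega, rfl⟩)), by omega⟩

lemma G2Three_isPairing {k : ℕ} (hk : 2 ≤ k) : (G2Three k).IsPairing {0} where
  n_large := by simp only [G2Three]; omega
  zero_mem := by simp
  coe_mem_blocks := Or.inr (by simp)
  lt_of_mem := by simp [G2Three]
  succ_notMem := by
    apply succ_mod_notMem_of_forall <;> simp [G2Three]
  disjoint := by
    rintro b ((⟨i, hi, hi', rfl⟩ | (⟨i, hi, rfl⟩ | ⟨i, hi, rfl⟩)) | rfl)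
      b' ((⟨j, hj, hj', rfl⟩ | (⟨j, hj, rfl⟩ | ⟨j, hj, rfl⟩)) | rfl) x hx hx' y hy <;>
    simp only [Set.mem_insert_iff, Set.mem_singleton_iff] at hx hx' hy ⊢ <;> omega
  exists_pair := by
    intro x hx hxC
    simp only [G2Three, Finset.mem_singleton] at hx hxC ⊢
    by_cases h2 : x % 2 = 0
    · by_cases h : x ≤ 4 * k + 2
      · exact ⟨_, _, Or.inl (Or.inl ⟨x / 2, by omega, by omega, rfl⟩), by omega⟩
      · exact ⟨_, _, Or.inl (Or.inl ⟨(x - (4 * k + 2)) / 2, by omega, by omega, rfl⟩), by omega⟩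
    · by_cases h : x < 2 * k + 3
      · exact ⟨_, _, Or.inl (Or.inr (Or.inl ⟨x / 2, by omega, rfl⟩)), by omega⟩
      by_cases h : x < 4 * k + 3
      · exact ⟨_, _, Or.inl (Or.inr (Or.inr ⟨(x - (2 * k + 3)) / 2, by omega, rfl⟩)), by omega⟩
      by_cases h : x < 6 * k + 3
      · exact ⟨_, _, Or.inl (Or.inr (Or.inr ⟨(x - (4 * k + 3)) / 2, by omega, rfl⟩)), by omega⟩
      · exact ⟨_, _, Or.inl (Or.inr (Or.inl ⟨(x - (6 * k + 3)) / 2, by omega, rfl⟩)), by omega⟩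

lemma G3One_isPairing {k : ℕ} (hk : 2 ≤ k) :
    (G3One k).IsPairing {0, 2 * k + 1, 6 * k + 2} where
  n_large := by simp only [G3One]; omega
  zero_mem := by simp
  coe_mem_blocks := Or.inr (by simp)
  lt_of_mem := by simp [G3One]; omega
  succ_notMem := by
    apply succ_mod_notMem_of_forall <;> simp [G3One] <;> omega
  disjoint := by
    rintro b (((⟨i, hi, hi', rfl⟩ | ⟨i, hi, hi', rfl⟩) | (⟨i, hi, rfl⟩ | ⟨i, hi, rfl⟩)) | rfl)
      b' (((⟨j, hj, hj', rfl⟩ | ⟨j, hj, hj', rfl⟩) | (⟨j, hj, rfl⟩ | ⟨j, hj, rfl⟩)) | rfl)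
      x hx hx' y hy <;>
    simp only [Set.mem_insert_iff, Set.mem_singleton_iff] at hx hx' hy ⊢ <;> omega
  exists_pair := by
    intro x hx hxC
    simp only [G3One, Finset.mem_insert, Finset.mem_singleton] at hx hxC ⊢
    by_cases h2 : x % 2 = 0
    · by_cases h : x ≤ 2 * k
      · exact ⟨_, _, Or.inl (Or.inl (Or.inl ⟨x / 2, by omega, by omega, rfl⟩)), by omega⟩
      by_cases h : x ≤ 4 * k
      · exact ⟨_, _, Or.inl (Or.inl (Or.inr ⟨(x - 2 * k) / 2, by omega, by omega, rfl⟩)), by omega⟩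
      by_cases h : x ≤ 6 * k
      · exact ⟨_, _, Or.inl (Or.inl (Or.inl ⟨(x - 4 * k) / 2, by omega, by omega, rfl⟩)), by omega⟩
      · exact ⟨_, _, Or.inl (Or.inl (Or.inr ⟨(x - (6 * k + 2)) / 2, by omega, by omega, rfl⟩)),
          by omega⟩
    · by_cases h : x < 2 * k + 1
      · exact ⟨_, _, Or.inl (Or.inr (Or.inl ⟨x / 2, by omega, rfl⟩)), by omega⟩
      by_cases h : x < 4 * k + 3
      · exact ⟨_, _, Or.inl (Or.inr (Or.inr ⟨(x - (2 * k + 3)) / 2, by omega, rfl⟩)), by omega⟩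
      by_cases h : x < 6 * k + 3
      · exact ⟨_, _, Or.inl (Or.inr (Or.inr ⟨(x - (4 * k + 3)) / 2, by omega, rfl⟩)), by omega⟩
      · exact ⟨_, _, Or.inl (Or.inr (Or.inl ⟨(8 * k + 1 - x) / 2, by omega, rfl⟩)), by omega⟩

lemma G3Three_isPairing {k : ℕ} (hk : 2 ≤ k) :
    (G3Three k).IsPairing {0, 2 * k + 2, 6 * k + 5} where
  n_large := by simp only [G3Three]; omega
  zero_mem := by simp
  coe_mem_blocks := Or.inr (by simp)
  lt_of_mem := by simp [G3Three]; omega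
  succ_notMem := by
    apply succ_mod_notMem_of_forall <;> simp [G3Three] <;> omega
  disjoint := by
    rintro b (((⟨i, hi, hi', rfl⟩ | ⟨i, hi, hi', rfl⟩) | (⟨i, hi, rfl⟩ | ⟨i, hi, rfl⟩)) | rfl)
      b' (((⟨j, hj, hj', rfl⟩ | ⟨j, hj, hj', rfl⟩) | (⟨j, hj, rfl⟩ | ⟨j, hj, rfl⟩)) | rfl)
      x hx hx' y hy <;>
    simp only [Set.mem_insert_iff, Set.mem_singleton_iff] at hx hx' hy ⊢ <;> omega
  exists_pair := by
    intro x hx hxC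
    simp only [G3Three, Finset.mem_insert, Finset.mem_singleton] at hx hxC ⊢
    by_cases h2 : x % 2 = 0
    · by_cases h : x ≤ 2 * k
      · exact ⟨_, _, Or.inl (Or.inl (Or.inl ⟨x / 2, by omega, by omega, rfl⟩)), by omega⟩
      by_cases h : x ≤ 4 * k + 4
      · exact ⟨_, _, Or.inl (Or.inl (Or.inr ⟨(x - (2 * k + 2)) / 2, by omega, by omega, rfl⟩)),
          by omega⟩
      by_cases h : x ≤ 6 * k + 4
      · exact ⟨_, _, Or.inl (Or.inl (Or.inl ⟨(x - (4 * k + 4)) / 2, by omega, by omega, rfl⟩)),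
          by omega⟩
      · exact ⟨_, _, Or.inl (Or.inl (Or.inr ⟨(x - (6 * k + 4)) / 2, by omega, by omega, rfl⟩)),
          by omega⟩
    · by_cases h : x < 4 * k + 3
      · by_cases h4 : x % 4 = 1
        · exact ⟨_, _, Or.inl (Or.inr (Or.inl ⟨x / 4, by omega, rfl⟩)), by omega⟩
        · exact ⟨_, _, Or.inl (Or.inr (Or.inr ⟨x / 4, by omega, rfl⟩)), by omega⟩
      by_cases h : x < 6 * k + 5
      · exact ⟨_, _, Or.inl (Or.inr (Or.inl ⟨(x - (4 * k + 3)) / 2, by omega, rfl⟩)), by omega⟩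
      · exact ⟨_, _, Or.inl (Or.inr (Or.inr ⟨(x - (6 * k + 7)) / 2, by omega, rfl⟩)), by omega⟩

open Finset

/-! ### Induced labels of a merged cycle -/

lemma cycle_inc {n e v : ℕ} : (cycle n).Inc e v ↔ e < n ∧ (v = e ∨ v = (e + 1) % n) := by
  constructor
  · rintro ⟨y, he, h | h⟩
    · exact ⟨he, Or.inl h.1⟩
    · exact ⟨he, Or.inr h.1⟩
  · rintro ⟨he, rfl | rfl⟩
    · exact ⟨_, he, Or.inl ⟨rfl, rfl⟩⟩
    · exact ⟨_, he, Or.inr ⟨rfl, rfl⟩⟩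

/-- The sum of the weights of the two edges of the `n`-cycle at the vertex `v_y`. -/
def cornerSum (n : ℕ) (w : ℕ → ℕ) (y : ℕ) : ℕ := w y + w ((y + n - 1) % n)

lemma succ_pred_mod {n y : ℕ} (hy : y < n) : ((y + n - 1) % n + 1) % n = y := by
  rw [Nat.mod_add_mod, show y + n - 1 + 1 = y + n by omega, Nat.add_mod_right, Nat.mod_eq_of_lt hy]

lemma pred_succ_mod {n y : ℕ} (hy : y < n) : ((y + 1) % n + n - 1) % n = y := by
  rcases Nat.lt_or_ge (y + 1) n with h | h
  · rw [Nat.mod_eq_of_lt h, show y + 1 + n - 1 = y + n by omega, Nat.add_mod_right,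
      Nat.mod_eq_of_lt hy]
  · obtain rfl : n = y + 1 := by omega
    rw [Nat.mod_self]
    simp

lemma cornerSum_of_pos {n y : ℕ} (w : ℕ → ℕ) (h0 : 0 < y) (hy : y < n) :
    cornerSum n w y = w y + w (y - 1) := by
  rw [cornerSum, show y + n - 1 = y - 1 + n by omega, Nat.add_mod_right,
    Nat.mod_eq_of_lt (by omega)]

lemma cornerSum_zero {n : ℕ} (w : ℕ → ℕ) (hn : 0 < n) : cornerSum n w 0 = w 0 + w (n - 1) := by
  rw [cornerSum, Nat.zero_add, Nat.mod_eq_of_lt (by omega)]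

lemma sum_filter_cornerSum (n : ℕ) (w : ℕ → ℕ) (P : ℕ → Prop) [DecidablePred P] :
    ∑ y ∈ range n with P y, cornerSum n w y =
      (∑ e ∈ range n, if P e then w e else 0) +
        ∑ e ∈ range n, if P ((e + 1) % n) then w e else 0 := by
  rw [sum_filter, ← sum_congr rfl fun y _ ↦ (show
    ((if P y then w y else 0) + if P y then w ((y + n - 1) % n) else 0) = _ by
      split_ifs <;> rfl), sum_add_distrib]
  congr 1
  refine sum_nbij' (fun y ↦ (y + n - 1) % n) (fun e ↦ (e + 1) % n) ?_ ?_ ?_ ?_ ?_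
  · intro y hy
    exact mem_range.2 (Nat.mod_lt _ (by have := mem_range.1 hy; omega))
  · intro y hy
    exact mem_range.2 (Nat.mod_lt _ (by have := mem_range.1 hy; omega))
  · intro y hy
    exact succ_pred_mod (mem_range.1 hy)
  · intro y hy
    exact pred_succ_mod (mem_range.1 hy)
  · intro y hy
    simp only [succ_pred_mod (mem_range.1 hy)]

open Classical in
lemma vertexLabel_map_cycle {V : Type*} (q : ℕ → V) (n : ℕ) (D : Set ℕ) (w : ℕ → ℕ)
    (hq : ∀ e < n, q e ≠ q ((e + 1) % n)) (hw : ∀ e ∈ D, w e = 0) (v : V) :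
    vertexLabel (((cycle n).map q).deleteEdges D) w v =
      ∑ y ∈ range n with q y = v, cornerSum n w y := by
  have hset : (((cycle n).map q).deleteEdges D).incidenceSet v =
      ((range n).filter fun e ↦ e ∉ D ∧ (q e = v ∨ q ((e + 1) % n) = v) : Finset ℕ) := by
    ext e
    simp only [Graph.mem_incidenceSet, Graph.deleteEdges_inc, Graph.map_inc, cycle_inc,
      coe_filter, Finset.mem_range, Set.mem_ofPred_eq]
    constructor
    · rintro ⟨⟨u, ⟨he, rfl | rfl⟩, rfl⟩, hD⟩
      · exact ⟨he, hD, Or.inl rfl⟩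
      · exact ⟨he, hD, Or.inr rfl⟩
    · rintro ⟨he, hD, rfl | rfl⟩
      · exact ⟨⟨_, ⟨he, Or.inl rfl⟩, rfl⟩, hD⟩
      · exact ⟨⟨_, ⟨he, Or.inr rfl⟩, rfl⟩, hD⟩
  rw [vertexLabel, hset, finsum_mem_coe_finset, sum_filter_cornerSum, sum_filter,
    ← sum_add_distrib]
  refine sum_congr rfl fun e he ↦ ?_
  by_cases hD : e ∈ D
  · simp [hw e hD]
  · by_cases h1 : q e = v
    · have h2 : q ((e + 1) % n) ≠ v := fun h ↦ hq e (mem_range.1 he) (h1.trans h.symm)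
      simp [h1, h2, hD]
    · simp [h1, hD]

namespace CycleMerging

variable {S : CycleMerging} {C : Finset ℕ}

/-- The vertex of the merged cycle that contains `v_j`. -/
def vertexOf (S : CycleMerging) (j : ℕ) : S.Vertex := Quot.mk _ j

lemma IsPairing.vertexOf_eq_iff (h : S.IsPairing C) {b : Set ℕ} (hb : b ∈ S.blocks) {x y : ℕ}
    (hx : x ∈ b) : S.vertexOf y = S.vertexOf x ↔ y ∈ b := by
  constructor
  · intro e
    have key : ∀ u v, (∃ b' ∈ S.blocks, u ∈ b' ∧ v ∈ b') → (u ∈ b) = (v ∈ b) := by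
      rintro u v ⟨b', hb', hu, hv⟩
      exact propext ⟨fun hub ↦ h.disjoint b' hb' b hb u hu hub v hv,
        fun hvb ↦ h.disjoint b' hb' b hb v hv hvb u hu⟩
    exact (congrArg (Quot.lift (· ∈ b) key) e).mpr hx
  · intro hy
    exact Quot.sound ⟨b, hb, hy, hx⟩

lemma IsPairing.vertexOf_eq_iff_mem (h : S.IsPairing C) {x y : ℕ} (hx : x ∈ C) :
    S.vertexOf y = S.vertexOf x ↔ y ∈ C := by
  simpa using h.vertexOf_eq_iff h.coe_mem_blocks (mem_coe.2 hx)

/-- `p` sends each vertex outside `C` to the one it is merged with. -/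
structure IsPartner (S : CycleMerging) (C : Finset ℕ) (p : ℕ → ℕ) : Prop where
  lt : ∀ x < S.n, x ∉ C → p x < S.n
  notMem : ∀ x < S.n, x ∉ C → p x ∉ C
  ne : ∀ x < S.n, x ∉ C → p x ≠ x
  mod_two : ∀ x < S.n, x ∉ C → p x % 2 = x % 2
  vertexOf_eq_iff : ∀ x < S.n, x ∉ C → ∀ y, S.vertexOf y = S.vertexOf x ↔ y = x ∨ y = p x

lemma IsPartner.involutive {p : ℕ → ℕ} (hp : S.IsPartner C p) {x : ℕ} (hx : x < S.n)
    (hxC : x ∉ C) : p (p x) = x := by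
  have h1 := (hp.vertexOf_eq_iff x hx hxC (p x)).2 (Or.inr rfl)
  have h2 := (hp.vertexOf_eq_iff _ (hp.lt x hx hxC) (hp.notMem x hx hxC) (p (p x))).2 (Or.inr rfl)
  exact ((hp.vertexOf_eq_iff x hx hxC _).1 (h2.trans h1)).resolve_right
    (hp.ne _ (hp.lt x hx hxC) (hp.notMem x hx hxC))

lemma IsPairing.exists_isPartner (h : S.IsPairing C) : ∃ p, S.IsPartner C p := by
  have key : ∀ x, ∃ y, x < S.n → x ∉ C → y < S.n ∧ y ∉ C ∧ y ≠ x ∧ y % 2 = x % 2 ∧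
      ∀ z, S.vertexOf z = S.vertexOf x ↔ z = x ∨ z = y := by
    intro x
    by_cases hx : x < S.n ∧ x ∉ C
    swap
    · exact ⟨0, fun h1 h2 ↦ absurd ⟨h1, h2⟩ hx⟩
    obtain ⟨a, b, hb, ha, hbn, hab, hmod, hxab⟩ := h.exists_pair x hx.1 hx.2
    have hmem : ∀ u, S.vertexOf u = S.vertexOf x ↔ u = a ∨ u = b := fun u ↦ by
      simpa using h.vertexOf_eq_iff hb (x := x) (y := u) (by simpa using hxab)
    have hC : ∀ u, u = a ∨ u = b → u ∉ C := fun u hu huC ↦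
      hx.2 ((h.vertexOf_eq_iff_mem huC).1 ((hmem u).2 hu).symm)
    rcases hxab with rfl | rfl
    · exact ⟨b, fun _ _ ↦ ⟨hbn, hC b (Or.inr rfl), hab.symm, hmod.symm, hmem⟩⟩
    · exact ⟨a, fun _ _ ↦ ⟨ha, hC a (Or.inl rfl), hab, hmod, fun z ↦ (hmem z).trans or_comm⟩⟩
  choose p hp using key
  exact ⟨p, ⟨fun x h1 h2 ↦ (hp x h1 h2).1, fun x h1 h2 ↦ (hp x h1 h2).2.1,
    fun x h1 h2 ↦ (hp x h1 h2).2.2.1, fun x h1 h2 ↦ (hp x h1 h2).2.2.2.1,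
    fun x h1 h2 ↦ (hp x h1 h2).2.2.2.2⟩⟩

lemma IsPairing.vertexOf_succ_ne (h : S.IsPairing C) {e : ℕ} (he : e < S.n) :
    S.vertexOf e ≠ S.vertexOf ((e + 1) % S.n) := by
  have hn := h.n_large
  intro heq
  by_cases heC : e ∈ C
  · exact h.succ_notMem e heC ((h.vertexOf_eq_iff_mem heC).1 heq.symm)
  · obtain ⟨p, hp⟩ := h.exists_isPartner
    have hmod := hp.mod_two e he heC
    rcases Nat.lt_or_ge (e + 1) S.n with h' | h'
    · rw [Nat.mod_eq_of_lt h'] at heq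
      rcases (hp.vertexOf_eq_iff e he heC _).1 heq.symm with h1 | h1 <;> omega
    · have : (e + 1) % S.n = 0 := by rw [show e + 1 = S.n by omega, Nat.mod_self]
      rw [this] at heq
      exact heC ((h.vertexOf_eq_iff_mem h.zero_mem).1 heq)

/-- The merged cycle without the edges in `D`. -/
def graphDelete (S : CycleMerging) (D : Set ℕ) : Graph S.Vertex ℕ := S.graph.deleteEdges D

lemma mem_edgeSet_graphDelete {D : Set ℕ} : (S.graphDelete D).edgeSet = Set.Iio S.n \ D := rfl

lemma vertexSet_graphDelete {D : Set ℕ} :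
    (S.graphDelete D).vertexSet = S.vertexOf '' Set.Iio S.n := rfl

lemma graphDelete_adj_iff {D : Set ℕ} {u v : S.Vertex} : (S.graphDelete D).Adj u v ↔
    ∃ e < S.n, e ∉ D ∧ (u = S.vertexOf e ∧ v = S.vertexOf ((e + 1) % S.n) ∨
      u = S.vertexOf ((e + 1) % S.n) ∧ v = S.vertexOf e) := by
  constructor
  · rintro ⟨e, ⟨x, y, ⟨he, ⟨rfl, rfl⟩ | ⟨rfl, rfl⟩⟩, rfl, rfl⟩, hD⟩
    · exact ⟨_, he, hD, Or.inl ⟨rfl, rfl⟩⟩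
    · exact ⟨_, he, hD, Or.inr ⟨rfl, rfl⟩⟩
  · rintro ⟨e, he, hD, ⟨rfl, rfl⟩ | ⟨rfl, rfl⟩⟩
    · exact ⟨e, ⟨_, _, ⟨he, Or.inl ⟨rfl, rfl⟩⟩, rfl, rfl⟩, hD⟩
    · exact ⟨e, ⟨_, _, ⟨he, Or.inr ⟨rfl, rfl⟩⟩, rfl, rfl⟩, hD⟩

lemma graphDelete_adj_succ {D : Set ℕ} {e : ℕ} (he : e + 1 < S.n) (hD : e ∉ D) :
    (S.graphDelete D).Adj (S.vertexOf e) (S.vertexOf (e + 1)) :=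
  graphDelete_adj_iff.2 ⟨e, by omega, hD, Or.inl ⟨rfl, by rw [Nat.mod_eq_of_lt he]⟩⟩

open Classical in
lemma IsPairing.vertexLabel_eq (h : S.IsPairing C) {D : Set ℕ} {w : ℕ → ℕ}
    (hw : ∀ e ∈ D, w e = 0) (v : S.Vertex) : vertexLabel (S.graphDelete D) w v =
      ∑ y ∈ range S.n with S.vertexOf y = v, cornerSum S.n w y :=
  vertexLabel_map_cycle S.vertexOf S.n D w (fun _ he ↦ h.vertexOf_succ_ne he) hw v

lemma IsPairing.vertexLabel_of_mem (h : S.IsPairing C) {D : Set ℕ} {w : ℕ → ℕ}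
    (hw : ∀ e ∈ D, w e = 0) {x : ℕ} (hx : x ∈ C) :
    vertexLabel (S.graphDelete D) w (S.vertexOf x) = ∑ y ∈ C, cornerSum S.n w y := by
  classical
  rw [h.vertexLabel_eq hw]
  refine sum_congr ?_ fun _ _ ↦ rfl
  ext y
  rw [mem_filter, mem_range, h.vertexOf_eq_iff_mem hx]
  exact ⟨fun h ↦ h.2, fun hy ↦ ⟨h.lt_of_mem y hy, hy⟩⟩

lemma IsPairing.vertexLabel_of_notMem (h : S.IsPairing C) {p : ℕ → ℕ} (hp : S.IsPartner C p)
    {D : Set ℕ} {w : ℕ → ℕ} (hw : ∀ e ∈ D, w e = 0) {x : ℕ} (hxn : x < S.n) (hx : x ∉ C) :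
    vertexLabel (S.graphDelete D) w (S.vertexOf x) =
      cornerSum S.n w x + cornerSum S.n w (p x) := by
  classical
  rw [h.vertexLabel_eq hw, ← sum_pair (hp.ne x hxn hx).symm]
  refine sum_congr ?_ fun _ _ ↦ rfl
  ext y
  rw [mem_filter, mem_range, hp.vertexOf_eq_iff x hxn hx, mem_insert, mem_singleton]
  refine ⟨fun h ↦ h.2, fun hy ↦ ⟨?_, hy⟩⟩
  rcases hy with rfl | rfl
  · exact hxn
  · exact hp.lt x hxn hx

/-! ### Connectedness -/

lemma IsPairing.isConnected (h : S.IsPairing C) {D : Set ℕ} (hD : D ⊆ {0} ∨ D ⊆ {1}) :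
    IsConnected (S.graphDelete D) := by
  have hn := h.n_large
  have hge : ∀ e, 2 ≤ e → e ∉ D := by
    intro e he heD
    rcases hD with hD | hD <;> have := hD heD <;> simp at this <;> omega
  have hreach : ∀ x, 2 ≤ x → x < S.n →
      Relation.ReflTransGen (S.graphDelete D).Adj (S.vertexOf 2) (S.vertexOf x) := by
    intro x hx
    induction x, hx using Nat.le_induction with
    | base => exact fun _ ↦ .refl
    | succ x hx ih => exact fun hlt ↦ (ih (by omega)).tail (graphDelete_adj_succ hlt (hge x hx))
  have h0 : Relation.ReflTransGen (S.graphDelete D).Adj (S.vertexOf 2) (S.vertexOf 0) := by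
    refine (hreach (S.n - 1) (by omega) (by omega)).tail (graphDelete_adj_iff.2
      ⟨S.n - 1, by omega, hge _ (by omega), Or.inl ⟨rfl, ?_⟩⟩)
    rw [show S.n - 1 + 1 = S.n by omega, Nat.mod_self]
  have h1 : Relation.ReflTransGen (S.graphDelete D).Adj (S.vertexOf 2) (S.vertexOf 1) := by
    by_cases hD0 : 0 ∈ D
    · have hD1 : 1 ∉ D := by
        intro h1
        rcases hD with hD | hD
        · simpa using hD h1
        · simpa using hD hD0
      exact .single (graphDelete_adj_succ (e := 1) (by omega) hD1).symm
    · exact h0.tail (graphDelete_adj_succ (e := 0) (by omega) hD0)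
  have hall : ∀ v ∈ (S.graphDelete D).vertexSet,
      Relation.ReflTransGen (S.graphDelete D).Adj (S.vertexOf 2) v := by
    rw [vertexSet_graphDelete]
    rintro _ ⟨x, hx, rfl⟩
    rcases (by omega : x = 0 ∨ x = 1 ∨ 2 ≤ x) with rfl | rfl | h2
    · exact h0
    · exact h1
    · exact hreach x h2 hx
  have hsymm : Std.Symm (S.graphDelete D).Adj := ⟨fun _ _ ↦ Graph.Adj.symm⟩
  refine ⟨⟨S.vertexOf 0, 0, Set.mem_Iio.2 (by omega), rfl⟩, fun u hu v hv ↦ ?_⟩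
  exact (Relation.ReflTransGen.stdSymm.symm _ _ (hall u hu)).trans (hall v hv)

end CycleMerging
/-! ### The cycle labeling and its shifts -/

lemma cLabel_of_even {n j : ℕ} (hj : j % 2 = 0) : cLabel n j = (j + 2) / 2 :=
  if_pos (Nat.even_iff.2 hj)

lemma cLabel_of_odd {n j : ℕ} (hj : j % 2 = 1) : cLabel n j = n - (j - 1) / 2 :=
  if_neg (by rw [Nat.even_iff]; omega)

lemma cLabel_cases (n j : ℕ) : j % 2 = 0 ∧ cLabel n j = (j + 2) / 2 ∨
    j % 2 = 1 ∧ cLabel n j = n - (j - 1) / 2 := by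
  rcases Nat.mod_two_eq_zero_or_one j with h | h
  · exact Or.inl ⟨h, cLabel_of_even h⟩
  · exact Or.inr ⟨h, cLabel_of_odd h⟩

lemma cLabel_zero (n : ℕ) : cLabel n 0 = 1 := rfl

lemma cLabel_one (n : ℕ) : cLabel n 1 = n := by simp [cLabel]

lemma cLabel_mem_Icc {n j : ℕ} (hj : j < n) : 1 ≤ cLabel n j ∧ cLabel n j ≤ n := by
  rcases cLabel_cases n j with ⟨h, e⟩ | ⟨h, e⟩ <;> omega

lemma injOn_cLabel (n : ℕ) : Set.InjOn (cLabel n) (Set.Iio n) := by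
  intro i hi j hj hij
  simp only [Set.mem_Iio] at hi hj
  rcases cLabel_cases n i with ⟨h, e⟩ | ⟨h, e⟩ <;>
  rcases cLabel_cases n j with ⟨h', e'⟩ | ⟨h', e'⟩ <;> omega

lemma exists_cLabel_eq {n m : ℕ} (h1 : 1 ≤ m) (hm : m ≤ n) : ∃ j < n, cLabel n j = m := by
  by_cases h : 2 * (m - 1) < n
  · exact ⟨2 * (m - 1), h, by rw [cLabel_of_even (by omega)]; omega⟩
  · exact ⟨2 * (n - m) + 1, by omega, by rw [cLabel_of_odd (by omega)]; omega⟩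

lemma bijOn_cLabel (n : ℕ) : Set.BijOn (cLabel n) (Set.Iio n) (Set.Icc 1 n) :=
  ⟨fun _ hj ↦ cLabel_mem_Icc hj, injOn_cLabel n, fun _ hm ↦ exists_cLabel_eq hm.1 hm.2⟩

lemma bijOn_cLabel_sub_one {n : ℕ} (hn : 2 ≤ n) :
    Set.BijOn (fun j ↦ cLabel n j - 1) (Set.Iio n \ {0}) (Set.Icc 1 (n - 1)) := by
  refine ⟨fun j hj ↦ ?_, fun i hi j hj hij ↦ ?_, fun m hm ↦ ?_⟩
  · have h1 := cLabel_mem_Icc hj.1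
    have h2 : cLabel n j ≠ cLabel n 0 := fun h ↦
      hj.2 (injOn_cLabel n hj.1 (Set.mem_Iio.2 (by omega)) h)
    rw [cLabel_zero] at h2
    exact ⟨by dsimp only; omega, by dsimp only; omega⟩
  · have h1 := cLabel_mem_Icc hi.1
    have h2 := cLabel_mem_Icc hj.1
    exact injOn_cLabel n hi.1 hj.1 (by dsimp only at hij; omega)
  · obtain ⟨h1, h2⟩ := hm
    obtain ⟨j, hj, hjm⟩ := exists_cLabel_eq (n := n) (m := m + 1) (by omega) (by omega)
    refine ⟨j, ⟨hj, fun h ↦ ?_⟩, by dsimp only; omega⟩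
    rw [Set.mem_singleton_iff.1 h, cLabel_zero] at hjm
    omega

lemma bijOn_sub_cLabel {n : ℕ} (hn : 2 ≤ n) :
    Set.BijOn (fun j ↦ n - cLabel n j) (Set.Iio n \ {1}) (Set.Icc 1 (n - 1)) := by
  refine ⟨fun j hj ↦ ?_, fun i hi j hj hij ↦ ?_, fun m hm ↦ ?_⟩
  · have h1 := cLabel_mem_Icc hj.1
    have h2 : cLabel n j ≠ cLabel n 1 := fun h ↦
      hj.2 (injOn_cLabel n hj.1 (Set.mem_Iio.2 (by omega)) h)
    rw [cLabel_one] at h2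
    exact ⟨by dsimp only; omega, by dsimp only; omega⟩
  · have h1 := cLabel_mem_Icc hi.1
    have h2 := cLabel_mem_Icc hj.1
    exact injOn_cLabel n hi.1 hj.1 (by dsimp only at hij; omega)
  · obtain ⟨h1, h2⟩ := hm
    obtain ⟨j, hj, hjm⟩ := exists_cLabel_eq (n := n) (m := n - m) (by omega) (by omega)
    refine ⟨j, ⟨hj, fun h ↦ ?_⟩, by dsimp only; omega⟩
    rw [Set.mem_singleton_iff.1 h, cLabel_one] at hjm
    omega

lemma ncard_Iio (n : ℕ) : (Set.Iio n).ncard = n := by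
  rw [← coe_Iio, Set.ncard_coe_finset, Nat.card_Iio]

lemma ncard_Iio_sdiff_singleton {n e : ℕ} (he : e < n) : (Set.Iio n \ {e}).ncard = n - 1 := by
  rw [Set.ncard_sdiff_singleton_of_mem (Set.mem_Iio.2 he), ncard_Iio]

namespace CycleMerging

variable {S : CycleMerging} {C : Finset ℕ}

/-! ### Upper bounds -/

lemma IsPairing.chiLa_le_three (h : S.IsPairing C) {D : Set ℕ} (hD : D ⊆ {0} ∨ D ⊆ {1})
    {w : ℕ → ℕ} (hw : ∀ e ∈ D, w e = 0)
    (hbij : Set.BijOn w (Set.Iio S.n \ D) (Set.Icc 1 (Set.Iio S.n \ D).ncard)) {a b : ℕ}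
    (ha : ∀ y < S.n, y % 2 = 1 → cornerSum S.n w y = a)
    (hb : ∀ y < S.n, 0 < y → y % 2 = 0 → cornerSum S.n w y = b) (hab : a ≠ b)
    (hCa : ∑ y ∈ C, cornerSum S.n w y ≠ 2 * a) (hCb : ∑ y ∈ C, cornerSum S.n w y ≠ 2 * b) :
    chiLa (S.graphDelete D) ≤ 3 := by
  have hn := h.n_large
  obtain ⟨p, hp⟩ := h.exists_isPartner
  set c := ∑ y ∈ C, cornerSum S.n w y with hc
  have hlabC : ∀ x ∈ C, vertexLabel (S.graphDelete D) w (S.vertexOf x) = c :=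
    fun x hx ↦ h.vertexLabel_of_mem hw hx
  have hlab1 : ∀ x < S.n, x ∉ C → x % 2 = 1 →
      vertexLabel (S.graphDelete D) w (S.vertexOf x) = 2 * a := by
    intro x hx hxC hx1
    rw [h.vertexLabel_of_notMem hp hw hx hxC, ha x hx hx1,
      ha _ (hp.lt x hx hxC) ((hp.mod_two x hx hxC).trans hx1), two_mul]
  have hpos : ∀ x, x ∉ C → 0 < x := fun x hx ↦
    Nat.pos_of_ne_zero fun h0 ↦ hx (h0 ▸ h.zero_mem)
  have hlab0 : ∀ x < S.n, x ∉ C → x % 2 = 0 →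
      vertexLabel (S.graphDelete D) w (S.vertexOf x) = 2 * b := by
    intro x hx hxC hx1
    rw [h.vertexLabel_of_notMem hp hw hx hxC, hb x hx (hpos x hxC) hx1,
      hb _ (hp.lt x hx hxC) (hpos _ (hp.notMem x hx hxC)) ((hp.mod_two x hx hxC).trans hx1),
      two_mul]
  have hlab : ∀ x < S.n, x ∉ C →
      x % 2 = 1 ∧ vertexLabel (S.graphDelete D) w (S.vertexOf x) = 2 * a ∨
      x % 2 = 0 ∧ vertexLabel (S.graphDelete D) w (S.vertexOf x) = 2 * b := by
    intro x hx hxC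
    rcases Nat.mod_two_eq_zero_or_one x with h0 | h1
    · exact Or.inr ⟨h0, hlab0 x hx hxC h0⟩
    · exact Or.inl ⟨h1, hlab1 x hx hxC h1⟩
  have hne : ∀ e < S.n, vertexLabel (S.graphDelete D) w (S.vertexOf e) ≠
      vertexLabel (S.graphDelete D) w (S.vertexOf ((e + 1) % S.n)) := by
    intro e he
    have hlt : (e + 1) % S.n < S.n := Nat.mod_lt _ (by omega)
    by_cases heC : e ∈ C
    · have := hlabC e heC
      rcases hlab _ hlt (h.succ_notMem e heC) with h' | h' <;> omega
    · by_cases heC' : (e + 1) % S.n ∈ C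
      · have := hlabC _ heC'
        rcases hlab _ he heC with h' | h' <;> omega
      · have h0 := hpos _ heC'
        have hs : (e + 1) % S.n = e + 1 := by
          rcases Nat.lt_or_ge (e + 1) S.n with h' | h'
          · exact Nat.mod_eq_of_lt h'
          · rw [show e + 1 = S.n by omega, Nat.mod_self] at h0
            omega
        rw [hs] at hlt heC' ⊢
        rcases hlab _ he heC with h' | h' <;> rcases hlab _ hlt heC' with h'' | h'' <;> omega
  have hanti : IsLocalAntimagic (S.graphDelete D) w := by
    refine ⟨h.isConnected hD, hbij, fun u v huv ↦ ?_⟩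
    obtain ⟨e, he, -, ⟨rfl, rfl⟩ | ⟨rfl, rfl⟩⟩ := graphDelete_adj_iff.1 huv
    · exact hne e he
    · exact (hne e he).symm
  refine (iInf₂_le w hanti).trans ?_
  have hsub : vertexLabel (S.graphDelete D) w '' (S.graphDelete D).vertexSet ⊆
      {c, 2 * a, 2 * b} := by
    rw [vertexSet_graphDelete]
    rintro _ ⟨_, ⟨x, hx, rfl⟩, rfl⟩
    by_cases hxC : x ∈ C
    · exact Or.inl (hlabC x hxC)
    · rcases hlab x hx hxC with h' | h'
      · exact Or.inr (Or.inl h'.2)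
      · exact Or.inr (Or.inr h'.2)
  refine (Set.encard_le_encard hsub).trans ((Set.encard_insert_le _ _).trans ?_)
  exact (add_le_add_left (Set.encard_insert_le _ _) 1).trans
    (by rw [Set.encard_singleton]; norm_num)

/-- The block of `v₀` has at most one further vertex of each parity. -/
def IsZeroBlock (n : ℕ) (C : Finset ℕ) : Prop :=
  C = {0} ∨ (∃ x, 0 < x ∧ x < n ∧ C = {0, x}) ∨
    ∃ x y, 0 < x ∧ x < n ∧ 0 < y ∧ y < n ∧ x % 2 ≠ y % 2 ∧ C = {0, x, y}

lemma IsZeroBlock.sum_eq {n : ℕ} (hC : IsZeroBlock n C) {s : ℕ → ℕ} {a b : ℕ}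
    (ha : ∀ y < n, y % 2 = 1 → s y = a) (hb : ∀ y < n, 0 < y → y % 2 = 0 → s y = b) :
    ∑ y ∈ C, s y = s 0 ∨ ∑ y ∈ C, s y = s 0 + a ∨ ∑ y ∈ C, s y = s 0 + b ∨
      ∑ y ∈ C, s y = s 0 + (a + b) := by
  have hs : ∀ y < n, 0 < y → y % 2 = 1 ∧ s y = a ∨ y % 2 = 0 ∧ s y = b := by
    intro y hy h0
    rcases Nat.mod_two_eq_zero_or_one y with h | h
    · exact Or.inr ⟨h, hb y hy h0 h⟩
    · exact Or.inl ⟨h, ha y hy h⟩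
  rcases hC with rfl | ⟨x, h0, hx, rfl⟩ | ⟨x, y, hx0, hx, hy0, hy, hxy, rfl⟩
  · simp
  · rw [sum_pair (by omega)]
    rcases hs x hx h0 with h | h <;> omega
  · rw [sum_insert (by simp; omega), sum_pair (by rintro rfl; exact hxy rfl)]
    rcases hs x hx hx0 with h | h <;> rcases hs y hy hy0 with h' | h' <;> omega

lemma IsPairing.chiLa_graph_le_three (h : S.IsPairing C) (hC : IsZeroBlock S.n C) :
    chiLa (S.graphDelete ∅) ≤ 3 := by
  have hn := h.n_large
  have ha : ∀ y < S.n, y % 2 = 1 → cornerSum S.n (cLabel S.n) y = S.n + 1 := by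
    intro y hy hy1
    rw [cornerSum_of_pos _ (by omega) hy, cLabel_of_odd hy1, cLabel_of_even (by omega)]
    omega
  have hb : ∀ y < S.n, 0 < y → y % 2 = 0 → cornerSum S.n (cLabel S.n) y = S.n + 2 := by
    intro y hy h0 hy1
    rw [cornerSum_of_pos _ h0 hy, cLabel_of_even hy1, cLabel_of_odd (by omega)]
    omega
  have h0 : cornerSum S.n (cLabel S.n) 0 = S.n / 2 + 2 := by
    rw [cornerSum_zero _ (by omega), cLabel_zero]
    rcases cLabel_cases S.n (S.n - 1) with h' | h' <;> omega
  have hsum := hC.sum_eq ha hb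
  refine h.chiLa_le_three (Or.inl (Set.empty_subset _)) (w := cLabel S.n) (by simp) ?_ ha hb
    (by omega) (by omega) (by omega)
  rw [Set.sdiff_empty, ncard_Iio]
  exact bijOn_cLabel _

lemma IsPairing.chiLa_delete_zero_le_three (h : S.IsPairing C) (hC : IsZeroBlock S.n C) :
    chiLa (S.graphDelete {0}) ≤ 3 := by
  have hn := h.n_large
  have ha : ∀ y < S.n, y % 2 = 1 →
      cornerSum S.n (fun j ↦ cLabel S.n j - 1) y = S.n - 1 := by
    intro y hy hy1
    rw [cornerSum_of_pos _ (by omega) hy, cLabel_of_odd hy1, cLabel_of_even (by omega)]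
    omega
  have hb : ∀ y < S.n, 0 < y → y % 2 = 0 →
      cornerSum S.n (fun j ↦ cLabel S.n j - 1) y = S.n := by
    intro y hy h0 hy1
    rw [cornerSum_of_pos _ h0 hy, cLabel_of_even hy1, cLabel_of_odd (by omega)]
    omega
  have h0 : cornerSum S.n (fun j ↦ cLabel S.n j - 1) 0 = S.n / 2 := by
    rw [cornerSum_zero _ (by omega), cLabel_zero]
    rcases cLabel_cases S.n (S.n - 1) with h' | h' <;> omega
  have hsum := hC.sum_eq ha hb
  refine h.chiLa_le_three (Or.inl subset_rfl) (w := fun j ↦ cLabel S.n j - 1)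
    (by simp [cLabel_zero]) ?_ ha hb (by omega) (by omega) (by omega)
  rw [ncard_Iio_sdiff_singleton (by omega)]
  exact bijOn_cLabel_sub_one (by omega)

lemma IsPairing.chiLa_delete_one_le_three (h : S.IsPairing C) (hC : IsZeroBlock S.n C) :
    chiLa (S.graphDelete {1}) ≤ 3 := by
  have hn := h.n_large
  have ha : ∀ y < S.n, y % 2 = 1 →
      cornerSum S.n (fun j ↦ S.n - cLabel S.n j) y = S.n - 1 := by
    intro y hy hy1
    rw [cornerSum_of_pos _ (by omega) hy, cLabel_of_odd hy1, cLabel_of_even (by omega)]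
    omega
  have hb : ∀ y < S.n, 0 < y → y % 2 = 0 →
      cornerSum S.n (fun j ↦ S.n - cLabel S.n j) y = S.n - 2 := by
    intro y hy h0 hy1
    rw [cornerSum_of_pos _ h0 hy, cLabel_of_even hy1, cLabel_of_odd (by omega)]
    omega
  have h0 : cornerSum S.n (fun j ↦ S.n - cLabel S.n j) 0 = 2 * S.n - S.n / 2 - 2 := by
    rw [cornerSum_zero _ (by omega), cLabel_zero]
    rcases cLabel_cases S.n (S.n - 1) with h' | h' <;> omega
  have hsum := hC.sum_eq ha hb
  refine h.chiLa_le_three (Or.inr subset_rfl) (w := fun j ↦ S.n - cLabel S.n j)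
    (by simp [cLabel_one]) ?_ ha hb (by omega) (by omega) (by omega)
  rw [ncard_Iio_sdiff_singleton (by omega)]
  exact bijOn_sub_cLabel (by omega)

end CycleMerging

/-! ### Lower bounds -/

lemma three_le_encard {α : Type*} {s : Set α} {a b c : α} (ha : a ∈ s) (hb : b ∈ s) (hc : c ∈ s)
    (hab : a ≠ b) (hac : a ≠ c) (hbc : b ≠ c) : 3 ≤ s.encard := by
  rw [← show ({a, b, c} : Set α).encard = 3 by
    rw [Set.encard_insert_of_notMem (by simp [hab, hac]), Set.encard_pair hbc]; rfl]
  apply Set.encard_le_encard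
  rintro x (rfl | rfl | rfl) <;> assumption

lemma IsLocalAntimagic.vertexLabel_eq_of_adj_adj {α β : Type*} {G : Graph α β} {f : β → ℕ}
    (hf : IsLocalAntimagic G f) (hc : colorNumber G f < 3) {x y z : α} (hxy : G.Adj x y)
    (hyz : G.Adj y z) : vertexLabel G f x = vertexLabel G f z := by
  by_contra hne
  obtain ⟨e, he⟩ := hxy
  obtain ⟨e', he'⟩ := hyz
  exact hc.not_ge (three_le_encard ⟨x, he.left_mem, rfl⟩ ⟨y, he.right_mem, rfl⟩
    ⟨z, he'.right_mem, rfl⟩ (hf.ne_of_adj _ _ ⟨e, he⟩) hne (hf.ne_of_adj _ _ ⟨e', he'⟩))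

namespace CycleMerging

variable {S : CycleMerging} {C : Finset ℕ} {D : Set ℕ} {f : ℕ → ℕ}

lemma vertexLabel_add_two (hf : IsLocalAntimagic (S.graphDelete D) f)
    (hc : colorNumber (S.graphDelete D) f < 3) {x : ℕ} (hx : x + 2 < S.n) (h1 : x ∉ D)
    (h2 : x + 1 ∉ D) : vertexLabel (S.graphDelete D) f (S.vertexOf (x + 2)) =
      vertexLabel (S.graphDelete D) f (S.vertexOf x) :=
  (hf.vertexLabel_eq_of_adj_adj hc (graphDelete_adj_succ (by omega) h1)
    (graphDelete_adj_succ hx h2)).symm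

lemma notMem_of_two_le (hD : D ⊆ {0} ∨ D ⊆ {1}) {e : ℕ} (he : 2 ≤ e) : e ∉ D := by
  intro heD
  rcases hD with hD | hD <;> have := hD heD <;> simp at this <;> omega

/-- With two colors, the colors alternate along `v₂ v₃ ⋯ v_{n-1} v₀`. -/
lemma vertexLabel_alternate (hD : D ⊆ {0} ∨ D ⊆ {1}) (hf : IsLocalAntimagic (S.graphDelete D) f)
    (hc : colorNumber (S.graphDelete D) f < 3) {x : ℕ} (hx : 2 ≤ x) (hxn : x < S.n) :
    vertexLabel (S.graphDelete D) f (S.vertexOf x) =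
      vertexLabel (S.graphDelete D) f (S.vertexOf (2 + x % 2)) := by
  induction x using Nat.strong_induction_on with
  | _ x ih =>
    rcases Nat.lt_or_ge x 4 with h4 | h4
    · rw [show 2 + x % 2 = x by omega]
    · obtain ⟨y, rfl⟩ := Nat.exists_eq_add_of_le' (show 2 ≤ x by omega)
      rw [vertexLabel_add_two hf hc hxn (notMem_of_two_le hD (by omega))
        (notMem_of_two_le hD (by omega)), ih y (by omega) (by omega) (by omega),
        Nat.add_mod_right]

lemma graphDelete_adj_last (hD : D ⊆ {0} ∨ D ⊆ {1}) (hn : 3 ≤ S.n) :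
    (S.graphDelete D).Adj (S.vertexOf (S.n - 1)) (S.vertexOf 0) :=
  graphDelete_adj_iff.2 ⟨S.n - 1, by omega, notMem_of_two_le hD (by omega),
    Or.inl ⟨rfl, by rw [show S.n - 1 + 1 = S.n by omega, Nat.mod_self]⟩⟩

lemma vertexLabel_zero_alternate (hn : 4 ≤ S.n) (hD : D ⊆ {0} ∨ D ⊆ {1})
    (hf : IsLocalAntimagic (S.graphDelete D) f) (hc : colorNumber (S.graphDelete D) f < 3) :
    vertexLabel (S.graphDelete D) f (S.vertexOf 0) =
      vertexLabel (S.graphDelete D) f (S.vertexOf (2 + S.n % 2)) := by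
  have h1 := graphDelete_adj_succ (S := S) (e := S.n - 2) (by omega)
    (notMem_of_two_le hD (by omega))
  rw [show S.n - 2 + 1 = S.n - 1 by omega] at h1
  rw [← hf.vertexLabel_eq_of_adj_adj hc h1 (graphDelete_adj_last hD (by omega)),
    vertexLabel_alternate hD hf hc (by omega) (by omega), show (S.n - 2) % 2 = S.n % 2 by omega]

lemma vertexLabel_two_ne_three (hn : 4 ≤ S.n) (hD : D ⊆ {0} ∨ D ⊆ {1})
    (hf : IsLocalAntimagic (S.graphDelete D) f) :
    vertexLabel (S.graphDelete D) f (S.vertexOf 2) ≠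
      vertexLabel (S.graphDelete D) f (S.vertexOf 3) :=
  hf.ne_of_adj _ _ (graphDelete_adj_succ (by omega) (notMem_of_two_le hD le_rfl))

lemma three_le_chiLa_of_forall {G : Graph S.Vertex ℕ}
    (h : ∀ f, IsLocalAntimagic G f → colorNumber G f < 3 → False) : 3 ≤ chiLa G :=
  le_iInf₂ fun f hf ↦ not_lt.1 (h f hf)

/-- If `v₀` is merged with a vertex at odd distance on the path `v₂ v₃ ⋯ v_{n-1} v₀`, then two
colors do not suffice. -/
lemma IsPairing.three_le_chiLa_of_mem (h : S.IsPairing C) (hD : D ⊆ {0} ∨ D ⊆ {1}) {x : ℕ}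
    (hxC : x ∈ C) (hx : 2 ≤ x) (hmod : x % 2 ≠ S.n % 2) : 3 ≤ chiLa (S.graphDelete D) := by
  have hn := h.n_large
  refine three_le_chiLa_of_forall fun f hf hc ↦ ?_
  have h0 := vertexLabel_zero_alternate (by omega) hD hf hc
  have h1 := vertexLabel_alternate hD hf hc hx (h.lt_of_mem x hxC)
  rw [(h.vertexOf_eq_iff_mem h.zero_mem).2 hxC, h0] at h1
  have h2 := vertexLabel_two_ne_three (by omega) hD hf
  rcases Nat.mod_two_eq_zero_or_one x with hx2 | hx2
  · rw [hx2, show S.n % 2 = 1 by omega] at h1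
    exact h2 h1.symm
  · rw [hx2, show S.n % 2 = 0 by omega] at h1
    exact h2 h1

lemma IsPairing.three_le_chiLa_of_odd (h : S.IsPairing C) (hD : D ⊆ {0} ∨ D ⊆ {1})
    (hodd : S.n % 2 = 1) (h1C : 1 ∉ C) (h0D : 0 ∉ D) : 3 ≤ chiLa (S.graphDelete D) := by
  have hn := h.n_large
  refine three_le_chiLa_of_forall fun f hf hc ↦ ?_
  obtain ⟨p, hp⟩ := h.exists_isPartner
  have hmod := hp.mod_two 1 (by omega) h1C
  have hne := hp.ne 1 (by omega) h1C
  have h1 := hf.vertexLabel_eq_of_adj_adj hc (graphDelete_adj_last hD (by omega))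
    (graphDelete_adj_succ (by omega) h0D)
  rw [zero_add, vertexLabel_alternate hD hf hc (by omega) (by omega),
    ← (hp.vertexOf_eq_iff 1 (by omega) h1C (p 1)).2 (Or.inr rfl),
    vertexLabel_alternate hD hf hc (by omega) (hp.lt 1 (by omega) h1C), hmod,
    show (S.n - 1) % 2 = 0 by omega] at h1
  exact vertexLabel_two_ne_three (by omega) hD hf h1

/-! ### Lower bounds by counting -/

lemma exists_weight (D : Set ℕ) (f : ℕ → ℕ) : ∃ w : ℕ → ℕ, (∀ e ∈ D, w e = 0) ∧
    (∀ e ∉ D, w e = f e) ∧ vertexLabel (S.graphDelete D) w = vertexLabel (S.graphDelete D) f := by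
  classical
  refine ⟨fun e ↦ if e ∈ D then 0 else f e, fun e he ↦ if_pos he, fun e he ↦ if_neg he, ?_⟩
  funext v
  exact finsum_mem_congr rfl fun e he ↦ if_neg (Graph.Inc.edge_mem he).2

lemma IsPairing.sum_vertexLabel (h : S.IsPairing C) {p : ℕ → ℕ} (hp : S.IsPartner C p)
    {w : ℕ → ℕ} (hw : ∀ e ∈ D, w e = 0) {A : Finset ℕ} (hA : ∀ x ∈ A, x < S.n ∧ x ∉ C ∧ p x ∈ A) :
    ∑ x ∈ A, vertexLabel (S.graphDelete D) w (S.vertexOf x) =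
      2 * ∑ x ∈ A, cornerSum S.n w x := by
  rw [sum_congr rfl fun x hx ↦ h.vertexLabel_of_notMem hp hw (hA x hx).1 (hA x hx).2.1,
    sum_add_distrib, two_mul]
  congr 1
  refine sum_nbij' p p (fun x hx ↦ (hA x hx).2.2) (fun x hx ↦ (hA x hx).2.2) ?_ ?_ fun _ _ ↦ rfl
  · exact fun x hx ↦ hp.involutive (hA x hx).1 (hA x hx).2.1
  · exact fun x hx ↦ hp.involutive (hA x hx).1 (hA x hx).2.1

lemma card_filter_odd (n : ℕ) : #{x ∈ range n | x % 2 = 1} = n / 2 := by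
  induction n with
  | zero => rfl
  | succ n ih =>
    rw [range_add_one, filter_insert]
    split_ifs
    · rw [card_insert_of_notMem (by simp), ih]; omega
    · rw [ih]; omega

lemma card_filter_even (n : ℕ) : #{x ∈ range n | x % 2 = 0} = (n + 1) / 2 := by
  induction n with
  | zero => rfl
  | succ n ih =>
    rw [range_add_one, filter_insert]
    split_ifs
    · rw [card_insert_of_notMem (by simp), ih]; omega
    · rw [ih]; omega

lemma succ_mod_mod_two {n : ℕ} (hn : n % 2 = 0) (e : ℕ) :
    (e + 1) % n % 2 = (e + 1) % 2 :=
  Nat.mod_mod_of_dvd _ (Nat.dvd_of_mod_eq_zero hn)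

lemma sum_cornerSum_odd {n : ℕ} (hn : n % 2 = 0) (w : ℕ → ℕ) :
    ∑ x ∈ range n with x % 2 = 1, cornerSum n w x = ∑ e ∈ range n, w e := by
  rw [sum_filter_cornerSum, ← sum_add_distrib]
  refine sum_congr rfl fun e _ ↦ ?_
  rw [succ_mod_mod_two hn]
  split_ifs <;> omega

lemma sum_cornerSum_even {n : ℕ} (hn : n % 2 = 0) (w : ℕ → ℕ) :
    ∑ x ∈ range n with x % 2 = 0, cornerSum n w x = ∑ e ∈ range n, w e := by
  rw [sum_filter_cornerSum, ← sum_add_distrib]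
  refine sum_congr rfl fun e _ ↦ ?_
  rw [succ_mod_mod_two hn]
  split_ifs <;> omega

lemma sum_cornerSum_odd_of_odd {m : ℕ} (w : ℕ → ℕ) :
    ∑ x ∈ range (2 * m + 1) with x % 2 = 1, cornerSum (2 * m + 1) w x =
      ∑ e ∈ range (2 * m), w e := by
  rw [sum_filter_cornerSum, ← sum_add_distrib, sum_range_succ, Nat.mod_self, if_neg (by omega),
    if_neg (by omega), Nat.add_zero, Nat.add_zero]
  refine sum_congr rfl fun e he ↦ ?_
  have := mem_range.1 he
  rw [Nat.mod_eq_of_lt (show e + 1 < 2 * m + 1 by omega)]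
  split_ifs <;> omega

/-- If the cycle is even and all merged vertices have equal parity, then the two sides of the
bipartition have equally many vertices of the cycle, and two colors do not suffice. -/
lemma IsPairing.three_le_chiLa_of_even (h : S.IsPairing C) (hD : D ⊆ {0} ∨ D ⊆ {1})
    (heven : S.n % 2 = 0) {m : ℕ} (hm0 : 0 < m) (hm : m % 2 = 0) (hC : C = {0, m}) :
    3 ≤ chiLa (S.graphDelete D) := by
  have hn := h.n_large
  refine three_le_chiLa_of_forall fun f hf hc ↦ ?_
  obtain ⟨p, hp⟩ := h.exists_isPartner
  obtain ⟨w, hw, -, hwf⟩ := exists_weight (S := S) D f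
  have hmn : m < S.n := h.lt_of_mem m (by simp [hC])
  have hmC : ∀ x, x ∈ C ↔ x = 0 ∨ x = m := by simp [hC]
  have hzero := vertexLabel_zero_alternate (by omega) hD hf hc
  rw [heven] at hzero
  have h1m : vertexLabel (S.graphDelete D) f (S.vertexOf 1) =
      vertexLabel (S.graphDelete D) f (S.vertexOf 3) := by
    have h1C : 1 ∉ C := by rw [hmC]; omega
    have hmod := hp.mod_two 1 (by omega) h1C
    have hne := hp.ne 1 (by omega) h1C
    rw [← (hp.vertexOf_eq_iff 1 (by omega) h1C (p 1)).2 (Or.inr rfl),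
      vertexLabel_alternate hD hf hc (by omega) (hp.lt 1 (by omega) h1C), hmod]
  have hodd := h.sum_vertexLabel hp hw (A := {x ∈ range S.n | x % 2 = 1}) (by
    intro x hx
    rw [mem_filter, mem_range] at hx
    have hxC : x ∉ C := by rw [hmC]; omega
    refine ⟨hx.1, hxC, ?_⟩
    rw [mem_filter, mem_range]
    exact ⟨hp.lt x hx.1 hxC, (hp.mod_two x hx.1 hxC).trans hx.2⟩)
  rw [sum_cornerSum_odd heven, hwf, sum_congr rfl (g := fun _ ↦
    vertexLabel (S.graphDelete D) f (S.vertexOf 3)), sum_const, card_filter_odd] at hodd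
  swap
  · intro x hx
    rw [mem_filter, mem_range] at hx
    rcases (by omega : x = 1 ∨ 2 ≤ x) with rfl | h2
    · exact h1m
    · rw [vertexLabel_alternate hD hf hc h2 hx.1, hx.2]
  have hev := h.sum_vertexLabel hp hw (A := {x ∈ range S.n | x % 2 = 0} \ C) (by
    intro x hx
    rw [mem_sdiff, mem_filter, mem_range] at hx
    refine ⟨hx.1.1, hx.2, ?_⟩
    rw [mem_sdiff, mem_filter, mem_range]
    exact ⟨⟨hp.lt x hx.1.1 hx.2, (hp.mod_two x hx.1.1 hx.2).trans hx.1.2⟩,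
      hp.notMem x hx.1.1 hx.2⟩)
  have hsub : C ⊆ {x ∈ range S.n | x % 2 = 0} := by
    intro x hx
    rw [mem_filter, mem_range]
    rcases (hmC x).1 hx with rfl | rfl <;> omega
  have hCsum : ∑ x ∈ C, vertexLabel (S.graphDelete D) w (S.vertexOf x) =
      2 * ∑ x ∈ C, cornerSum S.n w x := by
    rw [sum_congr rfl fun x hx ↦ h.vertexLabel_of_mem hw hx, sum_const, hC,
      card_pair (by omega), smul_eq_mul]
  have hev2 := congrArg₂ (· + ·) hev hCsum
  rw [← mul_add, sum_sdiff hsub, sum_sdiff hsub, sum_cornerSum_even heven, hwf,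
    sum_congr rfl (g := fun _ ↦ vertexLabel (S.graphDelete D) f (S.vertexOf 2)), sum_const,
    card_filter_even, show (S.n + 1) / 2 = S.n / 2 by omega, ← hodd, smul_eq_mul,
    smul_eq_mul] at hev2
  · exact vertexLabel_two_ne_three (by omega) hD hf
      (Nat.eq_of_mul_eq_mul_left (by omega) hev2)
  · intro x hx
    rw [mem_filter, mem_range] at hx
    rcases (by omega : x = 0 ∨ 2 ≤ x) with rfl | h2
    · exact hzero
    · rw [vertexLabel_alternate hD hf hc h2 hx.1, hx.2]

/-- If the cycle is odd, `v₀` is not merged and `v₀v₁` is deleted, then the only edge left at `v₀`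
would have to carry more than the largest label if two colors were to suffice. -/
lemma IsPairing.three_le_chiLa_delete_zero (h : S.IsPairing {0}) (hodd : S.n % 2 = 1) :
    3 ≤ chiLa (S.graphDelete {0}) := by
  have hn := h.n_large
  have hD : ({0} : Set ℕ) ⊆ {0} ∨ ({0} : Set ℕ) ⊆ {1} := Or.inl subset_rfl
  refine three_le_chiLa_of_forall fun f hf hc ↦ ?_
  obtain ⟨p, hp⟩ := h.exists_isPartner
  obtain ⟨w, hw, hw', hwf⟩ := exists_weight (S := S) {0} f
  obtain ⟨m, hm⟩ : ∃ m, S.n = 2 * m + 1 := ⟨S.n / 2, by omega⟩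
  have hzero := vertexLabel_zero_alternate (by omega) hD hf hc
  rw [hodd] at hzero
  set b := vertexLabel (S.graphDelete {0}) f (S.vertexOf (2 + 1)) with hb
  have hsum := h.sum_vertexLabel hp hw (A := {x ∈ range S.n | x % 2 = 1}) (by
    intro x hx
    rw [mem_filter, mem_range] at hx
    have hxC : x ∉ ({0} : Finset ℕ) := by rw [mem_singleton]; omega
    refine ⟨hx.1, hxC, ?_⟩
    rw [mem_filter, mem_range]
    exact ⟨hp.lt x hx.1 hxC, (hp.mod_two x hx.1 hxC).trans hx.2⟩)
  rw [hwf, sum_congr rfl (g := fun _ ↦ b), sum_const, card_filter_odd] at hsum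
  swap
  · intro x hx
    rw [mem_filter, mem_range] at hx
    rcases (by omega : x = 1 ∨ 2 ≤ x) with rfl | h2
    · have h1C : 1 ∉ ({0} : Finset ℕ) := by simp
      have hmod := hp.mod_two 1 (by omega) h1C
      have hne := hp.ne 1 (by omega) h1C
      rw [← (hp.vertexOf_eq_iff 1 (by omega) h1C (p 1)).2 (Or.inr rfl),
        vertexLabel_alternate hD hf hc (by omega) (hp.lt 1 (by omega) h1C), hmod]
    · rw [vertexLabel_alternate hD hf hc h2 hx.1, hx.2]
  have hlast : w (2 * m) = b := by
    rw [← hzero, ← hwf, h.vertexLabel_of_mem hw (mem_singleton_self 0), sum_singleton,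
      cornerSum_zero _ (by omega), hw 0 rfl, zero_add, hm, Nat.add_sub_cancel]
  have hbij := hf.bijOn
  rw [mem_edgeSet_graphDelete, ncard_Iio_sdiff_singleton (by omega), hm,
    Nat.add_sub_cancel] at hbij
  have hle : b ≤ 2 * m := by
    rw [← hlast, hw' _ (by simp; omega)]
    exact (hbij.mapsTo ⟨Set.mem_Iio.2 (by omega), by simp; omega⟩).2
  have htotal : ∑ e ∈ range (2 * m + 1), w e = ∑ i ∈ range (2 * m + 1), i := by
    rw [range_eq_Ico, sum_eq_sum_Ico_succ_bot (by omega) w, hw 0 rfl, zero_add,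
      sum_eq_sum_Ico_succ_bot (by omega) fun i ↦ i, zero_add, zero_add]
    refine sum_nbij f ?_ ?_ ?_ ?_
    · intro e he
      rw [mem_Ico] at he ⊢
      have := hbij.mapsTo (show e ∈ Set.Iio (2 * m + 1) \ {0} from
        ⟨Set.mem_Iio.2 (by omega), by simp; omega⟩)
      rw [Set.mem_Icc] at this
      omega
    · refine hbij.injOn.mono fun e he ↦ ?_
      rw [coe_Ico, Set.mem_Ico] at he
      exact ⟨Set.mem_Iio.2 (by omega), by simp; omega⟩
    · intro i hi
      rw [coe_Ico, Set.mem_Ico] at hi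
      obtain ⟨e, ⟨he, he0⟩, rfl⟩ := hbij.surjOn (show i ∈ Set.Icc 1 (2 * m) from
        ⟨by omega, by omega⟩)
      rw [Set.mem_Iio] at he
      rw [Set.mem_singleton_iff] at he0
      exact ⟨e, by rw [coe_Ico, Set.mem_Ico]; omega, rfl⟩
    · intro e he
      rw [mem_Ico] at he
      exact hw' e (by simp; omega)
  have hgauss := sum_range_id_mul_two (2 * m + 1)
  rw [hm, sum_cornerSum_odd_of_odd, smul_eq_mul, show (2 * m + 1) / 2 = m by omega] at hsum
  rw [sum_range_succ, hlast] at htotal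
  rw [← htotal, Nat.add_sub_cancel] at hgauss
  have hm8 : 8 ≤ m := by omega
  nlinarith

end CycleMerging

open CycleMerging

lemma CycleMerging.IsPairing.chiLa_eq_three {S : CycleMerging} {C : Finset ℕ}
    (h : S.IsPairing C) (hC : IsZeroBlock S.n C)
    (hlow : ∀ D : Set ℕ, D = ∅ ∨ D = {0} ∨ D = {1} → 3 ≤ chiLa (S.graphDelete D)) :
    chiLa S.graph = 3 ∧ ∀ e ∈ S.graph.edgeSet, cLabel S.n e = 1 ∨ cLabel S.n e = S.n →
      chiLa (S.graph.deleteEdges {e}) = 3 := by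
  have hn := h.n_large
  refine ⟨?_, fun e he hlab ↦ ?_⟩
  · have := (h.chiLa_graph_le_three hC).antisymm (hlow ∅ (Or.inl rfl))
    rwa [graphDelete, Graph.deleteEdges_empty] at this
  · rcases hlab with hlab | hlab
    · obtain rfl := injOn_cLabel S.n (x₁ := e) (x₂ := 0) he (Set.mem_Iio.2 (by omega))
        (hlab.trans (cLabel_zero _).symm)
      exact (h.chiLa_delete_zero_le_three hC).antisymm (hlow _ (Or.inr (Or.inl rfl)))
    · obtain rfl := injOn_cLabel S.n (x₁ := e) (x₂ := 1) he (Set.mem_Iio.2 (by omega))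
        (hlab.trans (cLabel_one _).symm)
      exact (h.chiLa_delete_one_le_three hC).antisymm (hlow _ (Or.inr (Or.inr rfl)))

lemma subset_zero_or_subset_one {D : Set ℕ} (hD : D = ∅ ∨ D = {0} ∨ D = {1}) :
    D ⊆ {0} ∨ D ⊆ {1} := by
  rcases hD with rfl | rfl | rfl <;> simp

lemma CycleMerging.IsPairing.three_le_chiLa_of_singleton {S : CycleMerging}
    (h : S.IsPairing {0}) (hodd : S.n % 2 = 1) (D : Set ℕ) (hD : D = ∅ ∨ D = {0} ∨ D = {1}) :
    3 ≤ chiLa (S.graphDelete D) := by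
  have hD' := subset_zero_or_subset_one hD
  rcases hD with rfl | rfl | rfl
  · exact h.three_le_chiLa_of_odd hD' hodd (by simp) (by simp)
  · exact h.three_le_chiLa_delete_zero hodd
  · exact h.three_le_chiLa_of_odd hD' hodd (by simp) (by simp)

end LocalAntimagic

open LocalAntimagic LocalAntimagic.CycleMerging in
theorem mainTheorem6 (k : ℕ) (hk : 2 ≤ k) (S : LocalAntimagic.CycleMerging)
    (hS : S = LocalAntimagic.G0Two k ∨
      S = LocalAntimagic.G1One k ∨ S = LocalAntimagic.G1Three k ∨
      S = LocalAntimagic.G2One k ∨ S = LocalAntimagic.G2Three k ∨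
      S = LocalAntimagic.G3One k ∨ S = LocalAntimagic.G3Three k) :
    LocalAntimagic.chiLa S.graph = 3 ∧
      ∀ e ∈ S.graph.edgeSet,
        LocalAntimagic.cLabel S.n e = 1 ∨ LocalAntimagic.cLabel S.n e = S.n →
          LocalAntimagic.chiLa (S.graph.deleteEdges {e}) = 3 := by
  rcases hS with rfl | rfl | rfl | rfl | rfl | rfl | rfl
  · exact (G0Two_isPairing hk).chiLa_eq_three
      (Or.inr (Or.inl ⟨_, by omega, by simp only [G0Two]; omega, rfl⟩))
      fun D hD ↦ (G0Two_isPairing hk).three_le_chiLa_of_even (subset_zero_or_subset_one hD)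
        (by simp only [G0Two]; omega) (by omega) (by omega) rfl
  · exact (G1One_isPairing hk).chiLa_eq_three
      (Or.inr (Or.inl ⟨_, by omega, by simp only [G1One]; omega, rfl⟩))
      fun D hD ↦ (G1One_isPairing hk).three_le_chiLa_of_mem (subset_zero_or_subset_one hD)
        (x := 4 * k + 1) (by simp) (by omega) (by simp only [G1One]; omega)
  · exact (G1Three_isPairing hk).chiLa_eq_three
      (Or.inr (Or.inl ⟨_, by omega, by simp only [G1Three]; omega, rfl⟩))
      fun D hD ↦ (G1Three_isPairing hk).three_le_chiLa_of_mem (subset_zero_or_subset_one hD)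
        (x := 4 * k + 3) (by simp) (by omega) (by simp only [G1Three]; omega)
  · exact (G2One_isPairing hk).chiLa_eq_three (Or.inl rfl)
      ((G2One_isPairing hk).three_le_chiLa_of_singleton (by simp only [G2One]; omega))
  · exact (G2Three_isPairing hk).chiLa_eq_three (Or.inl rfl)
      ((G2Three_isPairing hk).three_le_chiLa_of_singleton (by simp only [G2Three]; omega))
  · exact (G3One_isPairing hk).chiLa_eq_three
      (Or.inr (Or.inr ⟨_, _, by omega, by simp only [G3One]; omega, by omega,
        by simp only [G3One]; omega, by omega, rfl⟩))
      fun D hD ↦ (G3One_isPairing hk).three_le_chiLa_of_mem (subset_zero_or_subset_one hD)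
        (x := 6 * k + 2) (by simp) (by omega) (by simp only [G3One]; omega)
  · exact (G3Three_isPairing hk).chiLa_eq_three
      (Or.inr (Or.inr ⟨_, _, by omega, by simp only [G3Three]; omega, by omega,
        by simp only [G3Three]; omega, by omega, rfl⟩))
      fun D hD ↦ (G3Three_isPairing hk).three_le_chiLa_of_mem (subset_zero_or_subset_one hD)
        (x := 2 * k + 2) (by simp) (by omega) (by simp only [G3Three]; omega)
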